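/- Conventions. A cardinal is identified with its initial ordinal. A normal filter on an infinite regular cardinal $\kappa$ is a proper filter $D$ on $\kappa$ that contains every final segment $\{\alpha<\kappa:\alpha>\beta\}$ ($\beta<\kappa$) and is closed under diagonal intersections: if $X_i\in D$ for all $i<\kappa$, then $\{\alpha<\kappa:\alpha\in X_i\text{ for all }i<\alpha\}\in D$. A set $A\subseteq\kappa$ is $D$-positive if $\kappa\setminus A\notin D$. The game $\mathrm{GM}^*_{\omega+1}(D)$. A play has moves $\zeta=0,1,2,\dots,\omega$. In move $\zeta$ the first player chooses a $D$-positive set $A_\zeta\subseteq\kappa$, where $A_{n+1}\subseteq B_n$ for $n<\omega$, and $A_\omega$ must be equal to $\bigcap_{n<\omega}A_n$; then the second player chooses a $D$-positive set $B_\zeta\subseteq A_\zeta$. If the first player has no legal move (for proper $D$ this can occur only in move $\omega$, namely when $\bigcap_{n<\omega}A_n$ is not $D$-positive), he wins the play; if all $\omega+1$ moves are made, the second player wins. Squares. Let $\lambda$ be a regular cardinal, $\theta$ an ordinal and $S\subseteq\lambda$. A $(\le\theta)$-square for $S$ consists of a set $S^+$ with $S\subseteq S^+\subseteq\lambda$ and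 a sequence $\langle C_\alpha:\alpha\in S^+\rangle$ such that: each $C_\alpha$ is a subset of $\alpha$ that is closed in $\alpha$; if $\beta\in C_\alpha$, then $\beta\in S^+$ and $C_\beta=\beta\cap C_\alpha$; $\mathrm{otp}(C_\alpha)\le\theta$ for all $\alpha\in S^+$; and $\sup C_\delta=\delta$ for every limit ordinal $\delta\in S$. Claim. (1) Let $\lambda$ be an infinite regular cardinal, let $\theta<\lambda$ be a cardinal, and let $D$ be a normal filter on $\lambda^+$ with $\{\delta<\lambda^+:\mathrm{cf}(\delta)=\theta\}\in D$. Then the second player does not have a winning strategy in the game $\mathrm{GM}^*_{\omega+1}(D)$. (2) Let $\theta$ be an ordinal, let $\lambda>|\theta|^+$ be an infinite regular cardinal, and let $D$ be a normal filter on $\lambda$. Suppose that some $S\in D$ has a $(\le\theta)$-square or, more generally, just that every $D$-positive $S\subseteq\lambda$ has a $D$-positive subset $S'$ that has a $(\le\theta)$-square. Then the second player does not have a winning strategy in the game $\mathrm{GM}^*_{\omega+1}(D)$. -/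

import Mathlib

universe u

namespace ShelahGame

open Set

/-- The set of ordinals below the cardinal `κ` (i.e. `κ` itself as a von Neumann ordinal). -/
abbrev Below (κ : Cardinal.{u}) : Type (u + 1) := Set.Iio κ.ord

/-- `A ≠ ∅ mod D`: the complement of `A` does not belong to `D`. -/
def Positive {κ : Cardinal.{u}} (D : Filter (Below κ)) (A : Set (Below κ)) : Prop :=
  Aᶜ ∉ D

/-- Normal filter on `κ`: proper, contains every final segment of `κ`, and is closed under
diagonal intersections. -/
structure IsNormal {κ : Cardinal.{u}} (D : Filter (Below κ)) : Prop where
  proper : ∅ ∉ D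
  tail : ∀ β : Below κ, Set.Ioi β ∈ D
  diag : ∀ X : Below κ → Set (Below κ), (∀ i, X i ∈ D) → {α | ∀ i < α, α ∈ X i} ∈ D

/-- `S` has a `(≤ θ)`-square: there are `S⁺ ⊇ S` and `⟨C α : α ∈ S⁺⟩` with `C α` a closed
subset of `α`, coherent, of order type at most `θ`, and cofinal in `α` for limit `α ∈ S`.
The values of `C` outside `S⁺` are irrelevant. -/
def HasSquare {κ : Cardinal.{u}} (θ : Ordinal.{u}) (S : Set (Below κ)) : Prop :=
  ∃ (Splus : Set (Below κ)) (C : Below κ → Set (Below κ)),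
    S ⊆ Splus ∧
    (∀ α ∈ Splus, ∀ β ∈ C α, β ∈ Splus ∧ C β = Set.Iio β ∩ C α) ∧
    (∀ α ∈ Splus,
      Ordinal.type (fun x y : C α => x < y) ≤ Ordinal.lift.{u + 1} θ) ∧
    (∀ δ ∈ S, Order.IsSuccLimit (δ : Ordinal.{u}) → IsLUB (C δ) δ) ∧
    (∀ α ∈ Splus, C α ⊆ Set.Iio α ∧
      ∀ T ⊆ C α, T.Nonempty → ∀ δ < α, IsLUB T δ → δ ∈ C α)

/-! ### The game with shrinking positive sets

A play is a pair of sequences `A`, `B` of sets: in move `ζ` the first player chooses `A ζ` and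
then the second player chooses `B ζ`. -/

/-- `M` is a legal choice of the first player in move `ζ`, when `A ε`, `B ε` (`ε < ζ`) have been
chosen before. -/
def LegalFirst {κ : Cardinal.{u}} (D : Filter (Below κ)) (A B : Ordinal.{u} → Set (Below κ))
    (ζ : Ordinal.{u}) (M : Set (Below κ)) : Prop :=
  Positive D M ∧
  (∀ ε, ζ = Order.succ ε → M ⊆ B ε) ∧
  (Order.IsSuccLimit ζ → M = ⋂ ε ∈ Set.Iio ζ, A ε)

/-- `N` is a legal answer of the second player to the choice `M` of the first player. -/
def LegalSecond {κ : Cardinal.{u}} (D : Filter (Below κ)) (M N : Set (Below κ)) : Prop :=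
  Positive D N ∧ N ⊆ M

/-- All the moves before `ζ` are legal. -/
def LegalBefore {κ : Cardinal.{u}} (D : Filter (Below κ)) (A B : Ordinal.{u} → Set (Below κ))
    (ζ : Ordinal.{u}) : Prop :=
  ∀ ε < ζ, LegalFirst D A B ε (A ε) ∧ LegalSecond D (A ε) (B ε)

/-- A strategy of the second player: his answer in move `ζ` is a function of the choices of the
first player in the moves up to and including `ζ`. -/
abbrev Strategy (κ : Cardinal.{u}) : Type (u + 1) :=
  (ζ : Ordinal.{u}) → (Set.Iic ζ → Set (Below κ)) → Set (Below κ)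

/-- The answer of the strategy in move `ζ`, if the first player chooses `A ε` in move `ε`. -/
def Strategy.answer {κ : Cardinal.{u}} (σ : Strategy κ) (A : Ordinal.{u} → Set (Below κ))
    (ζ : Ordinal.{u}) : Set (Below κ) :=
  σ ζ fun ε => A ε

/-- `σ` is a winning strategy of the second player in the game `GM*_θ(D)`. The first player wins
if at some move `ζ < θ` he has no legal choice, and the second player wins if the play lasts
`θ` moves. So `σ` is winning iff, at every move `ζ < θ` reached by a legal play in which the
second player answered by `σ`, the first player has a legal choice, and to every legal choice
of his the answer of `σ` is legal. -/
def Strategy.IsWinning {κ : Cardinal.{u}} (σ : Strategy κ) (D : Filter (Below κ))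
    (θ : Ordinal.{u}) : Prop :=
  ∀ (A B : Ordinal.{u} → Set (Below κ)), ∀ ζ < θ,
    LegalBefore D A B ζ → (∀ ε < ζ, B ε = σ.answer A ε) →
      (∃ M, LegalFirst D A B ζ M) ∧
      (LegalFirst D A B ζ (A ζ) → LegalSecond D (A ζ) (σ.answer A ζ))

/-- The second player has a winning strategy in `GM*_θ(D)`. -/
def SecondWinsGMStar {κ : Cardinal.{u}} (D : Filter (Below κ)) (θ : Ordinal.{u}) : Prop :=
  ∃ σ : Strategy κ, σ.IsWinning D θ

end ShelahGame

namespace ShelahGame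

open Set

/-! ### Positive sets and pressing down for normal filters. -/

variable {κ : Cardinal.{u}} {D : Filter (Below κ)}

/-! Against a winning strategy, the intersection of the first player's moves in any legal ω-play is
positive. The first player exploits this by pressing down: each move decides one more ordinal
attached to all remaining δ.

Suppose positively many δ carry small coherent cofinal sets C δ, closed under ω-suprema. Cardinality
yields c < c' with c ∉ C c', each in C δ for positively many δ (`exists_incompatible`). Two plays,
one keeping c ∈ C δ and the other c' ∈ C δ, are run in parallel (`exists_run`), deciding interleaved
elements of the C δ. Their common supremum β lies in both kinds of C δ, so by coherence C β contains
both c and c', forcing c ∈ C c', a contradiction.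

A square is such a family. For (1) with θ uncountable, each δ < `lam`⁺ is enumerated in type `lam`,
and the images of a suitable initial segment i form such a family; pressing down makes i constant
(`exists_coherentOn_singleton`). For θ = ℵ₀ a single play decides an entire ladder, which cannot be
cofinal in two different δ. Finite θ is impossible, since D contains the set of limit ordinals. -/

theorem Positive.mono {A B : Set (Below κ)} (hA : Positive D A) (h : A ⊆ B) : Positive D B :=
  fun hB => hA (Filter.mem_of_superset hB (compl_subset_compl.2 h))

theorem Positive.inter {A X : Set (Below κ)} (hA : Positive D A) (hX : X ∈ D) :
    Positive D (A ∩ X) := fun h => hA <| by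
  filter_upwards [h, hX] with x hx hx' hxA
  exact hx ⟨hxA, hx'⟩

theorem IsNormal.positive_of_mem (hD : IsNormal D) {A : Set (Below κ)} (hA : A ∈ D) :
    Positive D A := fun h => hD.proper (by simpa using Filter.inter_mem hA h)

theorem IsNormal.exists_gt (hD : IsNormal D) {A : Set (Below κ)} (hA : Positive D A)
    (γ : Below κ) : ∃ δ ∈ A, γ < δ := by
  by_contra! h
  refine hA (Filter.mem_of_superset (hD.tail γ) fun δ hδ hδA => ?_)
  exact absurd hδ (not_lt.2 (h δ hδA))

/-- Fodor's lemma for a normal filter. -/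
theorem IsNormal.fodor (hD : IsNormal D) {A : Set (Below κ)} (hA : Positive D A)
    (f : Below κ → Below κ) (hf : ∀ δ ∈ A, f δ < δ) :
    ∃ β, Positive D {δ ∈ A | f δ = β} := by
  by_contra! h
  simp only [Positive, not_not] at h
  refine hA (Filter.mem_of_superset (hD.diag _ h) fun δ hδ hδA => ?_)
  exact hδ _ (hf δ hδA) ⟨hδA, rfl⟩

theorem IsNormal.fodor_exists (hD : IsNormal D) {A : Set (Below κ)} (hA : Positive D A)
    (p : Below κ → Below κ → Prop) (hp : ∀ δ ∈ A, ∃ β < δ, p δ β) :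
    ∃ β, Positive D {δ ∈ A | p δ β} := by
  classical
  choose! f hf using hp
  obtain ⟨β, hβ⟩ := hD.fodor hA f fun δ hδ => (hf δ hδ).1
  exact ⟨β, hβ.mono fun δ hδ => ⟨hδ.1, hδ.2 ▸ (hf δ hδ.1).2⟩⟩

theorem IsNormal.isSuccLimit_mem (hD : IsNormal D) (hκ : Cardinal.aleph0 ≤ κ) :
    {δ : Below κ | Order.IsSuccLimit (δ : Ordinal.{u})} ∈ D := by
  have hl := Cardinal.isSuccLimit_ord hκ
  have h0 : (0 : Ordinal.{u}) < κ.ord := hl.bot_lt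
  have hs : ∀ β : Below κ, Order.succ (β : Ordinal.{u}) < κ.ord := fun β => hl.succ_lt β.2
  filter_upwards [hD.diag (fun β => Ioi ⟨_, hs β⟩) fun β => hD.tail _, hD.tail ⟨0, h0⟩]
    with δ hδ hδ0
  have hδ0' : (0 : Ordinal.{u}) < δ := hδ0
  refine ⟨fun h => hδ0'.ne' (isMin_iff_eq_bot.1 h), fun b hb => ?_⟩
  have hbδ : b < (δ : Ordinal.{u}) := hb.1
  have : Order.succ b < (δ : Ordinal.{u}) := hδ ⟨b, hbδ.trans δ.2⟩ hbδ
  rw [hb.succ_eq] at this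
  exact this.false

/-! ### Plays of length `ω` -/

/-- The sequence of moves indexed by ordinals which agrees with `a` below `ω`. -/
def natPlay (a : ℕ → Set (Below κ)) : Ordinal.{u} → Set (Below κ) :=
  fun ζ => a (Cardinal.toNat ζ.card)

@[simp]
theorem natPlay_natCast (a : ℕ → Set (Below κ)) (n : ℕ) : natPlay a (n : Ordinal.{u}) = a n := by
  simp [natPlay]

/-- The answer of `σ` in move `n` of the play in which the first player follows `a`. -/
def Strategy.natAnswer (σ : Strategy κ) (a : ℕ → Set (Below κ)) (n : ℕ) : Set (Below κ) :=
  σ.answer (natPlay a) n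

/-- The strategy sees no later moves, so a play can be extended without disturbing earlier answers.
-/
theorem Strategy.natAnswer_congr (σ : Strategy κ) {a b : ℕ → Set (Below κ)} {n : ℕ}
    (h : ∀ m ≤ n, a m = b m) : σ.natAnswer a n = σ.natAnswer b n := by
  unfold Strategy.natAnswer Strategy.answer
  congr 1
  funext ⟨ζ, hζ⟩
  obtain ⟨m, rfl⟩ := Ordinal.lt_omega0.1 (lt_of_le_of_lt hζ (Ordinal.natCast_lt_omega0 n))
  have hm : m ≤ n := by simpa using hζ
  simp [h m hm]

/-- The moves `0, …, n` of `a` are legal against `σ`. -/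
def Strategy.LegalUpTo (σ : Strategy κ) (D : Filter (Below κ)) (a : ℕ → Set (Below κ))
    (n : ℕ) : Prop :=
  ∀ m ≤ n, Positive D (a m) ∧ ∀ k, m = k + 1 → a m ⊆ σ.natAnswer a k

theorem Strategy.LegalUpTo.legalFirst {σ : Strategy κ} {a : ℕ → Set (Below κ)} {n : ℕ}
    (h : σ.LegalUpTo D a n) :
    LegalFirst D (natPlay a) (σ.answer (natPlay a)) n (natPlay a n) := by
  rw [natPlay_natCast]
  refine ⟨(h n le_rfl).1, fun ε hε => ?_, fun hl => ?_⟩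
  · obtain ⟨k, rfl⟩ := Ordinal.lt_omega0.1
      ((Order.lt_succ ε).trans (hε ▸ Ordinal.natCast_lt_omega0 n))
    refine (h n le_rfl).2 k ?_
    have : (n : Ordinal.{u}) = ((k + 1 : ℕ) : Ordinal.{u}) := by
      rw [hε, Order.succ_eq_add_one]; simp
    exact_mod_cast this
  · exact absurd (Ordinal.omega0_le_of_isSuccLimit hl) (not_le.2 (Ordinal.natCast_lt_omega0 n))

theorem Strategy.LegalUpTo.mono {σ : Strategy κ} {a : ℕ → Set (Below κ)} {m n : ℕ}
    (h : σ.LegalUpTo D a n) (hmn : m ≤ n) : σ.LegalUpTo D a m :=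
  fun k hk => h k (hk.trans hmn)

theorem Strategy.IsWinning.legalSecond {σ : Strategy κ}
    (hσ : σ.IsWinning D (Ordinal.omega0 + 1)) {a : ℕ → Set (Below κ)} :
    ∀ {n : ℕ}, σ.LegalUpTo D a n → LegalSecond D (a n) (σ.natAnswer a n) := by
  intro n
  induction n using Nat.strong_induction_on with
  | _ n ih =>
    intro h
    have := (hσ (natPlay a) (σ.answer (natPlay a)) n
      ((Ordinal.natCast_lt_omega0 n).trans (lt_add_one _)) (fun ε hε => ?_) fun _ _ => rfl).2
      h.legalFirst
    · simpa using! this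
    · obtain ⟨m, rfl⟩ := Ordinal.lt_omega0.1 (hε.trans (Ordinal.natCast_lt_omega0 n))
      have hm : m < n := by simpa using hε
      exact ⟨(h.mono hm.le).legalFirst, by simpa using! ih m hm (h.mono hm.le)⟩

/-- In move ω the only candidate is the intersection, and a winning strategy guarantees that a legal
choice exists. -/
theorem Strategy.IsWinning.positive_iInter {σ : Strategy κ}
    (hσ : σ.IsWinning D (Ordinal.omega0 + 1)) {a : ℕ → Set (Below κ)}
    (h : ∀ n, σ.LegalUpTo D a n) : Positive D (⋂ n, a n) := by
  obtain ⟨M, hM⟩ := (hσ (natPlay a) (σ.answer (natPlay a)) Ordinal.omega0 (lt_add_one _)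
    (fun ε hε => by
      obtain ⟨m, rfl⟩ := Ordinal.lt_omega0.1 hε
      exact ⟨(h m).legalFirst, by simpa using! hσ.legalSecond (h m)⟩) fun _ _ => rfl).1
  refine hM.1.mono ?_
  rw [hM.2.2 Ordinal.isSuccLimit_omega0]
  refine subset_iInter fun n => ?_
  refine (biInter_subset_of_mem (mem_Iio.2 (Ordinal.natCast_lt_omega0 n))).trans ?_
  simp

theorem Strategy.LegalUpTo.update {σ : Strategy κ} {a : ℕ → Set (Below κ)} {n : ℕ}
    (h : σ.LegalUpTo D a n) {M : Set (Below κ)} (hM : Positive D M)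
    (hMs : M ⊆ σ.natAnswer a n) : σ.LegalUpTo D (Function.update a (n + 1) M) (n + 1) := by
  intro m hm
  have key : ∀ k ≤ n, σ.natAnswer (Function.update a (n + 1) M) k = σ.natAnswer a k :=
    fun k hk => σ.natAnswer_congr fun j hj => Function.update_of_ne (by omega) _ _
  rcases Nat.lt_or_eq_of_le hm with hm | rfl
  · rw [Function.update_of_ne hm.ne]
    refine ⟨(h m (by omega)).1, fun k hk => ?_⟩
    rw [key k (by omega)]
    exact (h m (by omega)).2 k hk
  · rw [Function.update_self]
    refine ⟨hM, fun k hk => ?_⟩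
    obtain rfl : n = k := by omega
    rwa [key n le_rfl]

/-- Against a winning strategy of the second player one can run a family of plays in parallel,
choosing the moves of all of them in round `n + 1` subject to a requirement `R n`. -/
theorem Strategy.IsWinning.exists_run {σ : Strategy κ}
    (hσ : σ.IsWinning D (Ordinal.omega0 + 1)) {ι X : Type*} (x₀ : X) (M₀ : ι → Set (Below κ))
    (hM₀ : ∀ i, Positive D (M₀ i)) (R : ℕ → X → X → (ι → Set (Below κ)) → Prop)
    (hR : ∀ n x (B : ι → Set (Below κ)), (∀ i, Positive D (B i)) → (∀ i, B i ⊆ M₀ i) →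
      ∃ x' M, (∀ i, Positive D (M i)) ∧ (∀ i, M i ⊆ B i) ∧ R n x x' M) :
    ∃ (x : ℕ → X) (a : ι → ℕ → Set (Below κ)), x 0 = x₀ ∧ (∀ i, a i 0 = M₀ i) ∧
      (∀ n, R n (x n) (x (n + 1)) fun i => a i (n + 1)) ∧
      ∀ i, Positive D (⋂ n, a i n) := by
  classical
  let Inv : ℕ → X × (ι → ℕ → Set (Below κ)) → Prop := fun n s =>
    ∀ i, σ.LegalUpTo D (s.2 i) n ∧ s.2 i 0 = M₀ i ∧ s.2 i n ⊆ M₀ i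
  have step : ∀ n (s : X × (ι → ℕ → Set (Below κ))), Inv n s →
      ∃ t : X × (ι → ℕ → Set (Below κ)), Inv (n + 1) t ∧
        (R n s.1 t.1 fun i => t.2 i (n + 1)) ∧ ∀ i, ∀ k ≤ n, t.2 i k = s.2 i k := by
    intro n s hs
    have hB := fun i => hσ.legalSecond (hs i).1
    obtain ⟨x', M, hM, hMB, hRM⟩ := hR n s.1 (fun i => σ.natAnswer (s.2 i) n)
      (fun i => (hB i).1) fun i => (hB i).2.trans (hs i).2.2
    refine ⟨⟨x', fun i => Function.update (s.2 i) (n + 1) (M i)⟩, fun i => ⟨?_, ?_, ?_⟩, ?_, ?_⟩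
    · exact (hs i).1.update (hM i) (hMB i)
    · simpa using (hs i).2.1
    · simpa using (hMB i).trans ((hB i).2.trans (hs i).2.2)
    · simpa using hRM
    · intro i k hk
      exact Function.update_of_ne (by omega) _ _
  have init : Inv 0 ⟨x₀, fun i _ => M₀ i⟩ := by
    refine fun i => ⟨fun m hm => ⟨hM₀ i, fun k hk => by omega⟩, rfl, subset_rfl⟩
  choose! next hnext using step
  let s : ℕ → X × (ι → ℕ → Set (Below κ)) :=
    fun n => Nat.rec ⟨x₀, fun i _ => M₀ i⟩ (fun n t => next n t) n
  have hs : ∀ n, Inv n (s n) := fun n => by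
    induction n with
    | zero => exact init
    | succ n ih => exact (hnext n (s n) ih).1
  have hstab : ∀ i k m, k ≤ m → (s m).2 i k = (s k).2 i k := by
    intro i k m hkm
    induction m, hkm using Nat.le_induction with
    | base => rfl
    | succ m hkm ih => exact ((hnext m (s m) (hs m)).2.2 i k hkm).trans ih
  -- Coordinate n never changes after stage n, so the limit plays are read off the diagonal.
  refine ⟨fun n => (s n).1, fun i n => (s n).2 i n, rfl, fun i => rfl,
    fun n => (hnext n (s n) (hs n)).2.1, fun i => hσ.positive_iInter fun n m hm => ?_⟩
  obtain ⟨h1, h2⟩ := ((hs m) i).1 m le_rfl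
  refine ⟨h1, fun k hk => (h2 k hk).trans (σ.natAnswer_congr fun j hj => ?_).subset⟩
  exact hstab i j m (by omega)

/-! ### Coherent families defeat every strategy. -/

theorem mk_Iio_below (δ : Below κ) :
    Cardinal.mk (Iio δ) = Cardinal.lift.{u + 1} (δ : Ordinal.{u}).card := by
  rw [← Cardinal.mk_Iio_ordinal]
  refine Cardinal.mk_congr ⟨fun x => ⟨x.1.1, x.2⟩, fun x => ⟨⟨x.1, lt_trans (mem_Iio.1 x.2) δ.2⟩, x.2⟩,
    fun _ => rfl, fun _ => rfl⟩

/-- A subset of a regular cardinal `κ` of cardinality less than `κ` is bounded. -/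
theorem exists_forall_lt_of_mk_lt (hκ : κ.IsRegular) {s : Set Ordinal.{u}}
    (hs : ∀ x ∈ s, x < κ.ord) (hc : Cardinal.mk s < Cardinal.lift.{u + 1} κ) :
    ∃ b < κ.ord, ∀ x ∈ s, x < b := by
  have hb : BddAbove ((· + 1) '' s) := by
    rw [Ordinal.bddAbove_add_one_image_iff]
    exact ⟨κ.ord, fun x hx => (hs x hx).le⟩
  refine ⟨sSup ((· + 1) '' s), ?_, fun x hx => ?_⟩
  · refine Ordinal.sSup_add_one_lt_of_lt_cof ?_ hs
    rwa [← Ordinal.lift_cof, hκ.cof_ord]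
  · exact (lt_add_one x).trans_le (le_csSup hb ⟨x, hx, rfl⟩)

theorem mk_eq_of_unbounded (hκ : κ.IsRegular) {T : Set (Below κ)}
    (hT : ∀ γ, ∃ β ∈ T, γ < β) : Cardinal.lift.{u + 1} κ ≤ Cardinal.mk T := by
  by_contra! h
  obtain ⟨b, hb, hb'⟩ := exists_forall_lt_of_mk_lt hκ (s := Subtype.val '' T)
    (by rintro _ ⟨x, -, rfl⟩; exact x.2) (Cardinal.mk_image_le.trans_lt h)
  obtain ⟨β, hβ, hlt⟩ := hT ⟨b, hb⟩
  exact (hb' β ⟨β, hβ, rfl⟩).not_gt hlt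

/-- A family of subsets `C δ ⊆ δ` for `δ ∈ S`, cofinal in `δ`, coherent, closed under suprema
of increasing `ω`-sequences, and of cardinality at most `μ`. -/
structure CoherentOn (S : Set (Below κ)) (C : Below κ → Set (Below κ))
    (μ : Cardinal.{u}) : Prop where
  subset : ∀ δ ∈ S, C δ ⊆ Iio δ
  unbounded : ∀ δ ∈ S, ∀ γ < δ, ∃ β ∈ C δ, γ < β
  coherent : ∀ δ ∈ S, ∀ β ∈ C δ, C β = Iio β ∩ C δ
  closed : ∀ δ ∈ S, ∀ b : ℕ → Below κ, StrictMono b → (∀ n, b n ∈ C δ) →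
    ∀ β < δ, IsLUB (range b) β → β ∈ C δ
  card_le : ∀ δ ∈ S, Cardinal.mk (C δ) ≤ Cardinal.lift.{u + 1} μ

namespace CoherentOn

variable {S : Set (Below κ)} {C : Below κ → Set (Below κ)} {μ : Cardinal.{u}}

/-- The pressing-down move: one element of C δ above γ is decided on a positive set. -/
theorem exists_positive_mem (hC : CoherentOn S C μ) (hD : IsNormal D) {A : Set (Below κ)}
    (hA : Positive D A) (hAS : A ⊆ S) (γ : Below κ) :
    ∃ β, γ < β ∧ Positive D {δ ∈ A | β ∈ C δ} := by
  obtain ⟨β, hβ⟩ := hD.fodor_exists (hA.inter (hD.tail γ)) (fun δ β => γ < β ∧ β ∈ C δ) <| by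
    rintro δ ⟨hδ, hγ⟩
    obtain ⟨β, hβ, hlt⟩ := hC.unbounded δ (hAS hδ) γ hγ
    exact ⟨β, hC.subset δ (hAS hδ) hβ, hlt, hβ⟩
  obtain ⟨δ, hδ, -⟩ := hD.exists_gt hβ γ
  exact ⟨β, hδ.2.1, hβ.mono fun δ hδ => ⟨hδ.1.1, hδ.2.2⟩⟩

/-- Two elements, each in `C δ` for positively many `δ ∈ S`, which are incompatible. -/
theorem exists_incompatible (hC : CoherentOn S C μ) (hκ : κ.IsRegular)
    (hμ : Order.succ μ < κ) (hD : IsNormal D) (hS : Positive D S) :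
    ∃ β β' : Below κ, β < β' ∧ β ∉ C β' ∧ Positive D {δ ∈ S | β ∈ C δ} ∧
      Positive D {δ ∈ S | β' ∈ C δ} := by
  by_contra! h
  let T : Set (Below κ) := {β | Positive D {δ ∈ S | β ∈ C δ}}
  have hT : ∀ γ, ∃ β ∈ T, γ < β := fun γ => by
    obtain ⟨β, h1, h2⟩ := hC.exists_positive_mem hD hS subset_rfl γ
    exact ⟨β, h2, h1⟩
  -- If all pairs in T were compatible, μ⁺ of its elements, bounded since μ⁺ < κ, would lie in a
  -- single C δ.
  obtain ⟨W, hWT, hW⟩ := Cardinal.le_mk_iff_exists_subset.1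
    ((Cardinal.lift_le.2 hμ.le).trans (mk_eq_of_unbounded hκ hT))
  obtain ⟨b, hb, hb'⟩ := exists_forall_lt_of_mk_lt hκ (s := Subtype.val '' W)
    (by rintro _ ⟨x, -, rfl⟩; exact x.2)
    (Cardinal.mk_image_le.trans_lt (hW ▸ Cardinal.lift_lt.2 hμ))
  obtain ⟨β', hβ', hlt⟩ := hT ⟨b, hb⟩
  obtain ⟨δ, ⟨hδS, hδ⟩, -⟩ := hD.exists_gt hβ' β'
  have hWC : W ⊆ C δ := by
    intro β hβ
    have hββ' : β < β' := (show (β : Ordinal.{u}) < b from hb' β ⟨β, hβ, rfl⟩).trans hlt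
    by_contra hn
    refine h β β' hββ' (fun hm => hn ?_) (hWT hβ) hβ'
    rw [hC.coherent δ hδS β' hδ] at hm
    exact hm.2
  have := ((Cardinal.mk_le_mk_of_subset hWC).trans (hC.card_le δ hδS))
  rw [hW, Cardinal.lift_le] at this
  exact (Order.lt_succ μ).not_ge this

theorem not_secondWins (hC : CoherentOn S C μ) (hκ : κ.IsRegular)
    (hμ : Order.succ μ < κ) (hD : IsNormal D) (hS : Positive D S) :
    ¬ SecondWinsGMStar D (Ordinal.omega0 + 1) := by
  rintro ⟨σ, hσ⟩
  obtain ⟨c, c', hcc', hinc, hc, hc'⟩ := hC.exists_incompatible hκ hμ hD hS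
  -- The shared state is the last ordinal decided in the `true` play; starting it at c' puts all
  -- decided ordinals above c'.
  obtain ⟨x, a, hx0, ha0, hR, hpos⟩ := hσ.exists_run (ι := Bool) c'
    (fun i => {δ ∈ S | cond i c' c ∈ C δ}) (by rintro (_ | _) <;> simpa)
    (fun _ x x' M => ∃ b, x < b ∧ b < x' ∧ (∀ δ ∈ M false, b ∈ C δ) ∧ ∀ δ ∈ M true, x' ∈ C δ) <| by
      intro n x B hB hBM
      obtain ⟨b, hxb, hb⟩ := hC.exists_positive_mem hD (hB false)
        ((hBM false).trans (sep_subset _ _)) x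
      obtain ⟨x', hbx', hx'⟩ := hC.exists_positive_mem hD (hB true)
        ((hBM true).trans (sep_subset _ _)) b
      refine ⟨x', fun i => cond i {δ ∈ B true | x' ∈ C δ} {δ ∈ B false | b ∈ C δ}, ?_, ?_, b,
        hxb, hbx', fun δ hδ => hδ.2, fun δ hδ => hδ.2⟩
      · rintro (_ | _) <;> assumption
      · rintro (_ | _) <;> exact sep_subset _ _
  choose b hxb hbx hbC hxC using hR
  have hxm : StrictMono x := strictMono_nat_of_lt_succ fun n => (hxb n).trans (hbx n)
  have hbm : StrictMono b := strictMono_nat_of_lt_succ fun n => (hbx n).trans (hxb (n + 1))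
  have hxm' : StrictMono fun n => x (n + 1) := fun m n h => hxm (by omega)
  have hmem : ∀ i, ∀ δ ∈ ⋂ n, a i n, δ ∈ S ∧ cond i c' c ∈ C δ := fun i δ hδ => by
    have := mem_iInter.1 hδ 0
    rwa [ha0] at this
  obtain ⟨δ₀, hδ₀, -⟩ := hD.exists_gt (hpos false) c
  have hbd : (upperBounds (range b)).Nonempty :=
    ⟨δ₀, by rintro _ ⟨n, rfl⟩; exact (hC.subset δ₀ (hmem _ _ hδ₀).1
      (hbC n δ₀ (mem_iInter.1 hδ₀ (n + 1)))).le⟩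
  let β := wellFounded_lt.min (upperBounds (range b)) hbd
  have hβ : IsLUB (range b) β :=
    ⟨wellFounded_lt.min_mem _ hbd, fun y hy => not_lt.1 (wellFounded_lt.not_lt_min _ hy)⟩
  have hβ' : IsLUB (range fun n => x (n + 1)) β := by
    refine ⟨?_, fun y hy => hβ.2 ?_⟩
    · rintro _ ⟨n, rfl⟩
      exact (hxb (n + 1)).le.trans (hβ.1 ⟨n + 1, rfl⟩)
    · rintro _ ⟨n, rfl⟩
      exact (hbx n).le.trans (hy ⟨n, rfl⟩)
  have hc'β : c' < β := (hx0 ▸ hxb 0).trans_le (hβ.1 ⟨0, rfl⟩)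
  obtain ⟨δ, hδ, hβδ⟩ := hD.exists_gt (hpos false) β
  obtain ⟨δ', hδ', hβδ'⟩ := hD.exists_gt (hpos true) β
  obtain ⟨hδS, hcδ⟩ := hmem _ _ hδ
  obtain ⟨hδS', hcδ'⟩ := hmem _ _ hδ'
  have h1 : β ∈ C δ := hC.closed δ hδS b hbm (fun n => hbC n δ (mem_iInter.1 hδ (n + 1))) β hβδ hβ
  have h2 : β ∈ C δ' := hC.closed δ' hδS' _ hxm'
    (fun n => hxC n δ' (mem_iInter.1 hδ' (n + 1))) β hβδ' hβ'
  -- C β is an initial part of both C δ and C δ', which transfers c from one to the other.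
  have hcβ : c ∈ C β := by
    rw [hC.coherent δ hδS β h1]
    exact ⟨hcc'.trans hc'β, hcδ⟩
  rw [hC.coherent δ' hδS' β h2] at hcβ
  refine hinc ?_
  rw [hC.coherent δ' hδS' c' hcδ']
  exact ⟨hcc', hcβ.2⟩

end CoherentOn

/-- A square is cofinal only at limit points of S, so S is cut down to limits, which form a set in
D. -/
theorem HasSquare.not_secondWins {θ : Ordinal.{u}} {S : Set (Below κ)} (h : HasSquare θ S)
    (hκ : κ.IsRegular) (hθ : Order.succ θ.card < κ) (hD : IsNormal D) (hS : Positive D S) :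
    ¬ SecondWinsGMStar D (Ordinal.omega0 + 1) := by
  obtain ⟨Sp, C, hSp, hcoh, hotp, hlub, hclosed⟩ := h
  have hC : CoherentOn (S ∩ {δ : Below κ | Order.IsSuccLimit (δ : Ordinal.{u})}) C θ.card := by
    refine ⟨fun δ hδ => (hclosed δ (hSp hδ.1)).1, fun δ hδ γ hγ => ?_,
      fun δ hδ β hβ => (hcoh δ (hSp hδ.1) β hβ).2, fun δ hδ b _ hb β hβδ hβ => ?_, fun δ hδ => ?_⟩
    · exact (lt_isLUB_iff (hlub δ hδ.1 hδ.2)).1 hγ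
    · exact (hclosed δ (hSp hδ.1)).2 _ (range_subset_iff.2 hb) (range_nonempty b) β hβδ hβ
    · have := Ordinal.card_le_card (hotp δ (hSp hδ.1))
      rwa [Ordinal.card_type, ← Ordinal.lift_card] at this
  exact hC.not_secondWins hκ hθ hD (hS.inter (hD.isSuccLimit_mem hκ.aleph0_le))

/-- If `D`-positively many `δ` are suprema of `ω`-sequences of smaller ordinals, then the second
player does not win. -/
theorem not_secondWins_of_ladder (hD : IsNormal D) {S : Set (Below κ)} (hS : Positive D S)
    (c : Below κ → ℕ → Below κ) (hlt : ∀ δ ∈ S, ∀ n, c δ n < δ)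
    (hcof : ∀ δ ∈ S, ∀ γ < δ, ∃ n, γ < c δ n) : ¬ SecondWinsGMStar D (Ordinal.omega0 + 1) := by
  rintro ⟨σ, hσ⟩
  obtain ⟨-, a, -, ha0, hR, hpos⟩ := hσ.exists_run (ι := Unit) () (fun _ => S) (fun _ => hS)
    (fun n _ _ M => ∃ β, ∀ δ ∈ M (), c δ n = β) <| by
      intro n _ B hB hBM
      obtain ⟨β, hβ⟩ := hD.fodor (hB ()) (fun δ => c δ n) fun δ hδ => hlt δ (hBM () hδ) n
      exact ⟨(), fun _ => {δ ∈ B () | c δ n = β}, fun _ => hβ, fun _ => sep_subset _ _, β,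
        fun δ hδ => hδ.2⟩
  choose b hb using hR
  obtain ⟨δ, hδ, -⟩ := hD.exists_gt (hpos ()) (b 0)
  obtain ⟨δ', hδ', hlt'⟩ := hD.exists_gt (hpos ()) δ
  have hS' : δ' ∈ S := by
    have := mem_iInter.1 hδ' 0
    rwa [ha0] at this
  have hSδ : δ ∈ S := by
    have := mem_iInter.1 hδ 0
    rwa [ha0] at this
  obtain ⟨n, hn⟩ := hcof δ' hS' δ hlt'
  -- Both δ < δ' have the same decided ladder, so it cannot pass δ.
  rw [hb n δ' (mem_iInter.1 hδ' (n + 1)), ← hb n δ (mem_iInter.1 hδ (n + 1))] at hn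
  exact hn.not_gt (hlt δ hSδ n)

/-! ### Coherent families from enumerations in type `lam`. -/

variable {lam : Cardinal.{u}}

/-- The continuous iteration of `H` along the ordinals. -/
noncomputable def iterSup (H : Ordinal.{u} → Ordinal.{u}) (ξ : Ordinal.{u}) : Ordinal.{u} :=
  ⨆ η : Iio ξ, H (iterSup H η)
termination_by ξ
decreasing_by exact η.2

theorem iterSup_lt (hlam : lam.IsRegular) {H : Ordinal.{u} → Ordinal.{u}}
    (hH : ∀ x < lam.ord, H x < lam.ord) : ∀ ξ < lam.ord, iterSup H ξ < lam.ord := by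
  intro ξ
  induction ξ using WellFoundedLT.induction with
  | _ ξ ih =>
    intro hξ
    rw [iterSup]
    refine Ordinal.sSup_lt_of_lt_cof (Cardinal.mk_range_le.trans_lt ?_) ?_
    · rw [← Ordinal.lift_cof, hlam.cof_ord, Cardinal.mk_Iio_ordinal, Cardinal.lift_lt]
      exact Cardinal.lt_ord.1 hξ
    · rintro _ ⟨η, rfl⟩
      exact hH _ (ih η η.2 (lt_trans (mem_Iio.1 η.2) hξ))

theorem lt_iterSup_iff {H : Ordinal.{u} → Ordinal.{u}} {ξ x : Ordinal.{u}} :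
    x < iterSup H ξ ↔ ∃ η < ξ, x < H (iterSup H η) := by
  rw [iterSup, Ordinal.lt_iSup_iff]
  simp

theorem le_iterSup {H : Ordinal.{u} → Ordinal.{u}} {ξ η : Ordinal.{u}} (h : η < ξ) :
    H (iterSup H η) ≤ iterSup H ξ :=
  not_lt.1 fun h' => (lt_iterSup_iff.2 ⟨η, h, h'⟩).false

/-- Below a regular cardinal above `ℵ₁` there are ordinals of uncountable cofinality closed under
a given binary operation. -/
theorem exists_closed_of_uncountable_cof (hlam : lam.IsRegular)
    (h1 : Cardinal.aleph 1 < lam) (F : Ordinal.{u} → Ordinal.{u} → Ordinal.{u})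
    (hF : ∀ k < lam.ord, ∀ j < lam.ord, F k j < lam.ord) {j₁ : Ordinal.{u}}
    (hj₁ : j₁ < lam.ord) :
    ∃ i < lam.ord, j₁ < i ∧ (∀ k < i, ∀ j < i, F k j < i) ∧
      ∀ s : ℕ → Ordinal.{u}, (∀ n, s n < i) → ∃ j < i, ∀ n, s n < j := by
  have hl := Cardinal.isSuccLimit_ord hlam.aleph0_le
  have hH : ∀ x, ∃ y, x < lam.ord → y < lam.ord ∧ x < y ∧ j₁ < y ∧
      ∀ k ≤ x, ∀ j ≤ x, F k j < y := by
    intro x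
    by_cases hx : x < lam.ord
    swap
    · exact ⟨0, fun h => absurd h hx⟩
    have hc : Cardinal.mk (Iic x) < Cardinal.lift.{u + 1} lam := by
      rw [← Order.Iio_succ, Cardinal.mk_Iio_ordinal, Cardinal.lift_lt, ← Cardinal.lt_ord]
      exact hl.succ_lt hx
    obtain ⟨b, hb, hb'⟩ := exists_forall_lt_of_mk_lt hlam (s := image2 F (Iic x) (Iic x))
      (by
        rintro _ ⟨k, hk, j, hj, rfl⟩
        exact hF k (lt_of_le_of_lt hk hx) j (lt_of_le_of_lt hj hx))
      (Cardinal.mk_image2_le.trans_lt (Cardinal.mul_lt_of_lt (by simpa using hlam.aleph0_le) hc hc))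
    refine ⟨max b (max (Order.succ x) (Order.succ j₁)), fun _ =>
      ⟨max_lt hb (max_lt (hl.succ_lt hx) (hl.succ_lt hj₁)), ?_, ?_, fun k hk j hj => ?_⟩⟩
    · simp
    · simp
    · exact (hb' _ ⟨k, hk, j, hj, rfl⟩).trans_le (le_max_left _ _)
  choose H hH using hH
  have hω : (Ordinal.omega 1 : Ordinal.{u}) < lam.ord := by
    rw [← Cardinal.ord_aleph]
    exact Cardinal.ord_lt_ord.2 h1
  have hωl : Order.IsSuccLimit (Ordinal.omega 1 : Ordinal.{u}) := by
    rw [← Cardinal.ord_aleph]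
    exact Cardinal.isSuccLimit_ord (Cardinal.aleph0_le_aleph 1)
  have hg := iterSup_lt hlam fun x hx => (hH x hx).1
  have hg' : ∀ η < Ordinal.omega 1, iterSup H η < lam.ord := fun η hη => hg η (hη.trans hω)
  have hsucc : ∀ η, ∀ x < H (iterSup H η), x < iterSup H (Order.succ η) := fun η x hx =>
    hx.trans_le (le_iterSup (Order.lt_succ η))
  have hmono : ∀ η ξ, η < ξ → ξ < Ordinal.omega 1 → iterSup H η < iterSup H ξ :=
    fun η ξ h hξ => (hH _ (hg' η (h.trans hξ))).2.1.trans_le (le_iterSup h)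
  have hmem : ∀ x < iterSup H (Ordinal.omega 1), ∃ η < Ordinal.omega 1, x < iterSup H η := by
    intro x hx
    obtain ⟨η, hη, hx⟩ := lt_iterSup_iff.1 hx
    exact ⟨Order.succ η, hωl.succ_lt hη, hsucc η x hx⟩
  -- Iterating ω₁ times gives closure under F, and countably many ordinals below the limit are
  -- bounded by an earlier stage.
  refine ⟨iterSup H (Ordinal.omega 1), hg _ hω, ?_, fun k hk j hj => ?_, fun s hs => ?_⟩
  · have h0 : (0 : Ordinal.{u}) < Ordinal.omega 1 := hωl.bot_lt
    exact (hH _ (hg' 0 h0)).2.2.1.trans_le (le_iterSup h0)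
  · obtain ⟨η, hη, hk⟩ := hmem k hk
    obtain ⟨ξ, hξ, hj⟩ := hmem j hj
    have hm : max η ξ < Ordinal.omega 1 := max_lt hη hξ
    have hle : ∀ ζ ≤ max η ξ, iterSup H ζ ≤ iterSup H (max η ξ) := fun ζ hζ => by
      rcases hζ.eq_or_lt with h | h
      · rw [h]
      · exact (hmono _ _ h hm).le
    refine ((hH _ (hg' _ hm)).2.2.2 k (hk.le.trans (hle _ (le_max_left _ _))) j
      (hj.le.trans (hle _ (le_max_right _ _)))).trans_le (le_iterSup hm)
  · choose η hη hsη using fun n => hmem (s n) (hs n)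
    have hsup : (⨆ n, η n) < Ordinal.omega 1 := Ordinal.iSup_lt_omega_one hη
    have hsup' := hωl.succ_lt hsup
    refine ⟨iterSup H (Order.succ (⨆ n, η n)), (hH _ (hg' _ hsup')).2.1.trans_le
      (le_iterSup hsup'), fun n => (hsη n).trans (hmono _ _ ?_ hsup')⟩
    exact Order.lt_succ_of_le (Ordinal.le_iSup η n)

theorem exists_surjOn_Iio (δ : Below (Order.succ lam)) :
    ∃ f : Ordinal.{u} → Below (Order.succ lam), ∀ x < δ, ∃ k < lam.ord, f k = x := by
  classical
  have h : Cardinal.mk (Iio δ) ≤ Cardinal.mk (Iio lam.ord) := by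
    rw [mk_Iio_below, Cardinal.mk_Iio_ordinal, Cardinal.lift_le, Cardinal.card_ord]
    exact Order.lt_succ_iff.1 (Cardinal.lt_ord.1 δ.2)
  obtain ⟨e⟩ := Cardinal.le_def _ _ |>.1 h
  -- Unused indices receive the value δ, which `initialImage` discards.
  refine ⟨fun k => if h : ∃ x, (e x : Ordinal.{u}) = k then h.choose else δ, fun x hx =>
    ⟨e ⟨x, hx⟩, (e ⟨x, hx⟩).2, ?_⟩⟩
  have hex : ∃ y, (e y : Ordinal.{u}) = e ⟨x, hx⟩ := ⟨_, rfl⟩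
  simp only [hex, dif_pos]
  rw [e.injective (Subtype.ext hex.choose_spec)]

/-- A set of cardinality `cof δ` which is cofinal in `δ`. -/
theorem exists_cofinal_subset (δ : Below κ)
    (hδ : Order.IsSuccLimit (δ : Ordinal.{u})) :
    ∃ s : Set (Below κ), (∀ x ∈ s, x < δ) ∧ (∀ γ < δ, ∃ x ∈ s, γ < x) ∧
      Cardinal.mk s ≤ Cardinal.lift.{u + 1} (δ : Ordinal.{u}).cof := by
  obtain ⟨s, hs, hc⟩ := Order.exists_cof_eq (Iio (δ : Ordinal.{u}))
  let e : Iio (δ : Ordinal.{u}) → Below κ := fun x => ⟨x, lt_trans (mem_Iio.1 x.2) δ.2⟩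
  refine ⟨e '' s, ?_, fun γ hγ => ?_, Cardinal.mk_image_le.trans ?_⟩
  · rintro _ ⟨x, -, rfl⟩
    exact x.2
  · obtain ⟨y, hy, hle⟩ := hs ⟨_, hδ.succ_lt hγ⟩
    exact ⟨e y, ⟨y, hy, rfl⟩, (Order.lt_succ (γ : Ordinal.{u})).trans_le hle⟩
  · rw [hc, Ordinal.cof_Iio, Ordinal.lift_cof]

/-- The part below `δ` of the image of `i` under `f δ`. -/
def initialImage (f : Below κ → Ordinal.{u} → Below κ) (i : Ordinal.{u})
    (δ : Below κ) : Set (Below κ) :=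
  {x | x < δ ∧ ∃ k < i, f δ k = x}

theorem mk_initialImage_le (f : Below κ → Ordinal.{u} → Below κ)
    (i : Ordinal.{u}) (δ : Below κ) :
    Cardinal.mk (initialImage f i δ) ≤ Cardinal.lift.{u + 1} i.card := by
  rw [← Cardinal.mk_Iio_ordinal]
  refine (Cardinal.mk_le_mk_of_subset ?_).trans (Cardinal.mk_image_le (f := f δ))
  rintro x ⟨-, k, hk, rfl⟩
  exact ⟨k, hk, rfl⟩

/-- If `cof δ < lam`, then some initial part of an enumeration of `δ` in type `lam` is cofinal in
`δ`, coherent, and closed under suprema of `ω`-sequences. -/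
theorem exists_coherentOn_singleton (hlam : lam.IsRegular) (h1 : Cardinal.aleph 1 < lam)
    (f : Below (Order.succ lam) → Ordinal.{u} → Below (Order.succ lam))
    (hf : ∀ δ, ∀ x < δ, ∃ k < lam.ord, f δ k = x) (δ : Below (Order.succ lam))
    (hδ : Order.IsSuccLimit (δ : Ordinal.{u})) (hcof : (δ : Ordinal.{u}).cof < lam) :
    ∃ i < lam.ord, CoherentOn {δ} (initialImage f i) i.card := by
  have hl := Cardinal.isSuccLimit_ord hlam.aleph0_le
  choose! idx hidx hfidx using hf
  obtain ⟨s, hsδ, hs, hsc⟩ := exists_cofinal_subset δ hδ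
  obtain ⟨j₁, hj₁, hj₁s⟩ := exists_forall_lt_of_mk_lt hlam (s := idx δ '' s)
    (by
      rintro _ ⟨x, hx, rfl⟩
      exact hidx δ x (hsδ x hx))
    (Cardinal.mk_image_le.trans_lt (hsc.trans_lt (Cardinal.lift_lt.2 hcof)))
  -- For β = f δ k, the first two clauses give the two inclusions of coherence at β. The third gives
  -- closure: the values of f β on j that are below β either have a bound x < β of small index, or
  -- are already cofinal in β.
  have hF : ∀ k j, ∃ y, k < lam.ord → j < lam.ord → y < lam.ord ∧ (f δ k < δ →
      (f (f δ k) j < f δ k → idx δ (f (f δ k) j) < y) ∧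
      (f δ j < f δ k → idx (f δ k) (f δ j) < y) ∧
      ((∃ x < f δ k, idx (f δ k) x < y ∧ ∀ m < j, f (f δ k) m < f δ k → f (f δ k) m ≤ x) ∨
        ∀ γ < f δ k, ∃ m < y, γ < f (f δ k) m ∧ f (f δ k) m < f δ k)) := by
    intro k j
    by_cases hj : j < lam.ord
    swap
    · exact ⟨0, fun _ h => absurd h hj⟩
    by_cases hk : f δ k < δ
    swap
    · exact ⟨0, fun _ _ => ⟨hlam.ord_pos, fun h => absurd h hk⟩⟩
    have e1 : ∃ y < lam.ord, f (f δ k) j < f δ k → idx δ (f (f δ k) j) < y := by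
      by_cases h : f (f δ k) j < f δ k
      · exact ⟨_, hl.succ_lt (hidx δ _ (h.trans hk)), fun _ => Order.lt_succ _⟩
      · exact ⟨0, hlam.ord_pos, fun h' => absurd h' h⟩
    have e2 : ∃ y < lam.ord, f δ j < f δ k → idx (f δ k) (f δ j) < y := by
      by_cases h : f δ j < f δ k
      · exact ⟨_, hl.succ_lt (hidx _ _ h), fun _ => Order.lt_succ _⟩
      · exact ⟨0, hlam.ord_pos, fun h' => absurd h' h⟩
    have e3 : ∃ y < lam.ord,
        (∃ x < f δ k, idx (f δ k) x < y ∧ ∀ m < j, f (f δ k) m < f δ k → f (f δ k) m ≤ x) ∨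
        ∀ γ < f δ k, ∃ m < y, γ < f (f δ k) m ∧ f (f δ k) m < f δ k := by
      by_cases h : ∃ x < f δ k, ∀ m < j, f (f δ k) m < f δ k → f (f δ k) m ≤ x
      · obtain ⟨x, hx, hxm⟩ := h
        exact ⟨_, hl.succ_lt (hidx _ x hx), Or.inl ⟨x, hx, Order.lt_succ _, hxm⟩⟩
      · push Not at h
        refine ⟨j, hj, Or.inr fun γ hγ => ?_⟩
        obtain ⟨m, hm, h1, h2⟩ := h γ hγ
        exact ⟨m, hm, h2, h1⟩
    obtain ⟨y1, hy1, e1⟩ := e1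
    obtain ⟨y2, hy2, e2⟩ := e2
    obtain ⟨y3, hy3, e3⟩ := e3
    refine ⟨max y1 (max y2 y3), fun _ _ => ⟨max_lt hy1 (max_lt hy2 hy3), fun _ =>
      ⟨fun h => (e1 h).trans_le (by simp), fun h => (e2 h).trans_le (by simp), ?_⟩⟩⟩
    refine e3.imp ?_ ?_
    · rintro ⟨x, hx, hxy, hxm⟩
      exact ⟨x, hx, hxy.trans_le (by simp), hxm⟩
    · intro h γ hγ
      obtain ⟨m, hm, hm'⟩ := h γ hγ
      exact ⟨m, hm.trans_le (by simp), hm'⟩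
  choose F hF using hF
  obtain ⟨i, hi, hji, hFi, hω⟩ := exists_closed_of_uncountable_cof hlam h1 F
    (fun k hk j hj => (hF k j hk hj).1) hj₁
  have hFi' := fun k (hk : k < i) j (hj : j < i) => (hF k j (hk.trans hi) (hj.trans hi)).2
  have hunb : ∀ γ < δ, ∃ β ∈ initialImage f i δ, γ < β := fun γ hγ => by
    obtain ⟨x, hx, hlt⟩ := hs γ hγ
    exact ⟨x, ⟨hsδ x hx, idx δ x, (hj₁s _ ⟨x, hx, rfl⟩).trans hji, hfidx δ x (hsδ x hx)⟩, hlt⟩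
  have hcoh : ∀ β ∈ initialImage f i δ, initialImage f i β = Iio β ∩ initialImage f i δ := by
    rintro β ⟨hβ, k, hk, rfl⟩
    ext x
    constructor
    · rintro ⟨hx, j, hj, rfl⟩
      exact ⟨hx, hx.trans hβ, _, ((hFi' k hk j hj hβ).1 hx).trans (hFi k hk j hj),
        hfidx δ _ (hx.trans hβ)⟩
    · rintro ⟨hx, -, j, hj, rfl⟩
      exact ⟨hx, _, ((hFi' k hk j hj hβ).2.1 hx).trans (hFi k hk j hj), hfidx _ _ hx⟩
  refine ⟨i, hi, ?_, ?_, ?_, ?_, ?_⟩ <;> rintro δ' rfl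
  · exact fun x hx => hx.1
  · exact hunb
  · exact hcoh
  · intro b _ hb β hβδ hβ
    by_contra hβC
    -- A missing supremum β is examined from the next element β' of the family: no element lies in
    -- [β, β'), while the indices of all b n in the enumeration of β' are bounded by some j < i.
    -- Either alternative of the third clause then produces an element in that gap.
    obtain ⟨β', ⟨hCm, hβm⟩, hmin⟩ := wellFounded_lt.has_min
      {x | x ∈ initialImage f i δ' ∧ β < x} (hunb β hβδ)
    have hcoh' := hcoh β' hCm
    have hbβ' : ∀ n, b n ∈ initialImage f i β' := fun n => by
      rw [hcoh']
      exact ⟨(hβ.1 ⟨n, rfl⟩).trans_lt hβm, hb n⟩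
    have hgap : ∀ x ∈ initialImage f i β', ¬ β < x := fun x hx hlt => by
      rw [hcoh'] at hx
      exact hmin x ⟨hx.2, hlt⟩ hx.1
    choose hb1 t ht htb using hbβ'
    obtain ⟨j, hj, htj⟩ := hω t ht
    obtain ⟨hβ'δ, k, hk, rfl⟩ := hCm
    have hy := hFi k hk j hj
    rcases (hFi' k hk j hj hβ'δ).2.2 with ⟨x, hx, hxy, hxm⟩ | h
    · have hxC : x ∈ initialImage f i (f δ' k) := ⟨hx, _, hxy.trans hy, hfidx _ _ hx⟩
      have hle : β ≤ x := hβ.2 <| by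
        rintro _ ⟨n, rfl⟩
        rw [← htb n]
        exact hxm (t n) (htj n) (by rw [htb n]; exact hb1 n)
      rcases hle.eq_or_lt with rfl | hlt
      · rw [hcoh'] at hxC
        exact hβC hxC.2
      · exact hgap x hxC hlt
    · obtain ⟨m, hm, hlt, hm'⟩ := h β hβm
      exact hgap _ ⟨hm', m, hm.trans hy, rfl⟩ hlt
  · exact mk_initialImage_le f i δ'

/-- Above `lam` the index i(δ) < `lam` is regressive, so it is constant on a positive set; the
resulting sets have size |i| < `lam`, whence |i|⁺ < `lam`⁺. -/
theorem not_secondWins_of_uncountable_cof (hlam : lam.IsRegular) {θ : Cardinal.{u}}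
    (h0 : Cardinal.aleph0 < θ) (hθ : θ < lam) {D : Filter (Below (Order.succ lam))}
    (hD : IsNormal D) (hS : {δ : Below (Order.succ lam) | (δ : Ordinal.{u}).cof = θ} ∈ D) :
    ¬ SecondWinsGMStar D (Ordinal.omega0 + 1) := by
  have h1 : Cardinal.aleph 1 < lam := by
    refine lt_of_le_of_lt ?_ hθ
    rw [← Cardinal.succ_aleph0]
    exact Order.succ_le_of_lt h0
  choose f hf using exists_surjOn_Iio (lam := lam)
  have hreg := Cardinal.isRegular_succ hlam.aleph0_le
  have hlt : lam.ord < (Order.succ lam).ord := Cardinal.ord_lt_ord.2 (Order.lt_succ lam)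
  have hmem := Filter.inter_mem hS
    (Filter.inter_mem (hD.isSuccLimit_mem hreg.aleph0_le) (hD.tail ⟨_, hlt⟩))
  obtain ⟨i, hi⟩ := hD.fodor_exists (hD.positive_of_mem hmem)
    (fun δ i => (i : Ordinal.{u}) < lam.ord ∧
      CoherentOn {δ} (initialImage f i) (i : Ordinal.{u}).card) <| by
    rintro δ ⟨hδc, hδl, hδ⟩
    obtain ⟨i, hi, hC⟩ := exists_coherentOn_singleton hlam h1 f hf δ hδl
      (lt_of_eq_of_lt hδc hθ)
    exact ⟨⟨i, hi.trans hlt⟩, lt_trans hi hδ, hi, hC⟩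
  obtain ⟨δ, hδ, -⟩ := hD.exists_gt hi i
  refine CoherentOn.not_secondWins (C := initialImage f i) (μ := (i : Ordinal.{u}).card)
    ⟨fun δ hδ => hδ.2.2.subset δ rfl, fun δ hδ => hδ.2.2.unbounded δ rfl,
      fun δ hδ => hδ.2.2.coherent δ rfl, fun δ hδ => hδ.2.2.closed δ rfl,
      fun δ hδ => hδ.2.2.card_le δ rfl⟩ hreg ?_ hD hi
  exact (Order.succ_le_of_lt (Cardinal.lt_ord.1 hδ.2.1)).trans_lt (Order.lt_succ lam)

theorem not_secondWins_of_countable_cof (hκ : Cardinal.aleph0 ≤ κ) (hD : IsNormal D)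
    (hS : {δ : Below κ | (δ : Ordinal.{u}).cof = Cardinal.aleph0} ∈ D) :
    ¬ SecondWinsGMStar D (Ordinal.omega0 + 1) := by
  have hmem := Filter.inter_mem hS (hD.isSuccLimit_mem hκ)
  have hc : ∀ δ : Below κ, ∃ c : ℕ → Below κ,
      (δ : Ordinal.{u}).cof = Cardinal.aleph0 ∧ Order.IsSuccLimit (δ : Ordinal.{u}) →
      (∀ n, c n < δ) ∧ ∀ γ < δ, ∃ n, γ < c n := by
    intro δ
    by_cases h : (δ : Ordinal.{u}).cof = Cardinal.aleph0 ∧ Order.IsSuccLimit (δ : Ordinal.{u})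
    swap
    · exact ⟨fun _ => δ, fun h' => absurd h' h⟩
    obtain ⟨s, hsδ, hs, hsc⟩ := exists_cofinal_subset δ h.2
    rw [h.1, Cardinal.lift_aleph0, Cardinal.le_aleph0_iff_set_countable] at hsc
    obtain ⟨x, hx, -⟩ := hs ⟨0, lt_trans h.2.bot_lt δ.2⟩ h.2.bot_lt
    obtain ⟨c, rfl⟩ := hsc.exists_eq_range ⟨x, hx⟩
    refine ⟨c, fun _ => ⟨fun n => hsδ _ ⟨n, rfl⟩, fun γ hγ => ?_⟩⟩
    obtain ⟨_, ⟨n, rfl⟩, hn⟩ := hs γ hγ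
    exact ⟨n, hn⟩
  choose c hc using hc
  exact not_secondWins_of_ladder hD (hD.positive_of_mem hmem) c (fun δ hδ => (hc δ hδ).1)
    fun δ hδ => (hc δ hδ).2

end ShelahGame

theorem claim9 :
    (∀ (lam θ : Cardinal.{u}) (D : Filter (ShelahGame.Below (Order.succ lam))),
      lam.IsRegular → θ < lam → ShelahGame.IsNormal D →
      {δ : ShelahGame.Below (Order.succ lam) | (δ : Ordinal.{u}).cof = θ} ∈ D →
      ¬ ShelahGame.SecondWinsGMStar D (Ordinal.omega0 + 1)) ∧
    (∀ (lam : Cardinal.{u}) (θ : Ordinal.{u}) (D : Filter (ShelahGame.Below lam)),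
      lam.IsRegular → Order.succ θ.card < lam → ShelahGame.IsNormal D →
      ((∃ S ∈ D, ShelahGame.HasSquare θ S) ∨
        (∀ S : Set (ShelahGame.Below lam), ShelahGame.Positive D S →
          ∃ S' ⊆ S, ShelahGame.Positive D S' ∧ ShelahGame.HasSquare θ S')) →
      ¬ ShelahGame.SecondWinsGMStar D (Ordinal.omega0 + 1)) := by
  refine ⟨fun lam θ D hlam hθ hD hS => ?_, fun lam θ D hlam hθ hD hS => ?_⟩
  · have hκ := (Cardinal.isRegular_succ hlam.aleph0_le).aleph0_le
    rcases lt_trichotomy θ Cardinal.aleph0 with h | rfl | h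
    · refine absurd (Filter.inter_mem hS (hD.isSuccLimit_mem hκ)) fun hmem => hD.proper ?_
      refine Filter.mem_of_superset hmem fun δ hδ => ?_
      have h1 := Ordinal.aleph0_le_cof_iff.2 (Ordinal.one_lt_cof_iff.2 hδ.2)
      rw [show (δ : Ordinal.{u}).cof = θ from hδ.1] at h1
      exact absurd h (not_lt.2 h1)
    · exact ShelahGame.not_secondWins_of_countable_cof hκ hD hS
    · exact ShelahGame.not_secondWins_of_uncountable_cof hlam h hθ hD hS
  · rcases hS with ⟨S, hS, hsq⟩ | h
    · exact hsq.not_secondWins hlam hθ hD (hD.positive_of_mem hS)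
    · obtain ⟨S, -, hS, hsq⟩ := h Set.univ (hD.positive_of_mem Filter.univ_mem)
      exact hsq.not_secondWins hlam hθ hD hS
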